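/- Let $\mathbb D=\{|z|<1\}$, $\mathbb T=\{|z|=1\}$, $\mathbb E=\{|z|>1\}$. Let $\mathfrak p\in\mathbb C[z,w]$ be an irreducible polynomial that is inner toral, i.e. whose zero set satisfies $Z(\mathfrak p)\subset\mathbb D^2\cup\mathbb T^2\cup\mathbb E^2$. Let $(n,m)$ be its bidegree ($n$ the degree in $z$, $m$ the degree in $w$), put $\mathfrak V(\mathfrak p)=Z(\mathfrak p)\cap\mathbb D^2$, and let $\alpha$ be a positive integer. A rank $\alpha$ admissible kernel over $\mathfrak V(\mathfrak p)$ is a function $K$ on $\mathfrak V(\mathfrak p)\times\mathfrak V(\mathfrak p)$ with values in the $\alpha\times\alpha$ complex matrices for which there exist an $\alpha\times m\alpha$ matrix polynomial $Q$ and an $\alpha\times n\alpha$ matrix polynomial $P$, each of full rank $\alpha$ at some point of $\mathfrak V(\mathfrak p)$, such that $$\frac{Q(z,w)Q(\zeta,\eta)^*}{1-z\overline{\zeta}}=K((z,w),(\zeta,\eta))=\frac{P(z,w)P(\zeta,\eta)^*}{1-w\overline{\eta}}\qquad\text{for all }(z,w),(\zeta,\eta)\in\mathfrak V(\mathfrak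 p).$$ Such a $K$ is positive semidefinite; let $\mathcal H^2(K)$ be the associated reproducing kernel Hilbert space of $\mathbb C^\alpha$-valued functions on $\mathfrak V(\mathfrak p)$. A pure isopair on a Hilbert space $\mathcal H$ is a pair $(S,T)$ of commuting isometries with $\bigcap_j S^j\mathcal H=\{0\}=\bigcap_j T^j\mathcal H$ such that $q(S,T)=0$ for some nonzero $q\in\mathbb C[z,w]$. It is nearly $\alpha$-cyclic if there are $f_1,\dots,f_\alpha\in\mathcal H$ such that the closure of $$\Big\{\sum_{j=1}^{\alpha}q_j(S,T)f_j : q_j\in\mathbb C[z,w]\Big\}$$ has finite codimension in $\mathcal H$, and if this holds for no smaller number of vectors. **Theorem.** If $K$ is a rank $\alpha$ admissible kernel over $\mathfrak V(\mathfrak p)$, then multiplication by $z$ and multiplication by $w$ define bounded operators $S=M_z$ and $T=M_w$ on $\mathcal H^2(K)$, and $(S,T)$ is a pure isopair that is nearly $\alpha$-cyclic. -/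

import Mathlib

/-- The value at `(z, w)` of a polynomial in two variables; variable `0` is `z`, variable `1` is
`w`. -/
noncomputable def polyVal (q : MvPolynomial (Fin 2) ℂ) (z w : ℂ) : ℂ :=
  MvPolynomial.eval ![z, w] q

/-- `q` is inner toral: its zero set is contained in `𝔻² ∪ 𝕋² ∪ 𝔼²`, where `𝔻`, `𝕋`, `𝔼` are the
open unit disk, the unit circle and the complement of the closed unit disk. -/
def InnerToral (q : MvPolynomial (Fin 2) ℂ) : Prop :=
  ∀ z w : ℂ, polyVal q z w = 0 →
    (‖z‖ < 1 ∧ ‖w‖ < 1) ∨ (‖z‖ = 1 ∧ ‖w‖ = 1) ∨ (1 < ‖z‖ ∧ 1 < ‖w‖)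

/-- The part `Z(p) ∩ 𝔻²` of the zero set of `p` in the open bidisk. -/
def diskVariety (p : MvPolynomial (Fin 2) ℂ) : Set (ℂ × ℂ) :=
  {x | ‖x.1‖ < 1 ∧ ‖x.2‖ < 1 ∧ polyVal p x.1 x.2 = 0}

/-- The value of a matrix polynomial at a point of the variety. -/
noncomputable def matVal {p : MvPolynomial (Fin 2) ℂ} {a b : ℕ}
    (Q : Matrix (Fin a) (Fin b) (MvPolynomial (Fin 2) ℂ)) (x : diskVariety p) :
    Matrix (Fin a) (Fin b) ℂ :=
  Q.map fun q => polyVal q x.1.1 x.1.2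

/-- `(K, P, Q)` is an `α`-admissible triple over `Z(p) ∩ 𝔻²`, where the bidegree of `p` is
`(n, m) = (p.degreeOf 0, p.degreeOf 1)`. -/
structure IsAdmissibleTriple (p : MvPolynomial (Fin 2) ℂ) (α : ℕ)
    (K : diskVariety p → diskVariety p → Matrix (Fin α) (Fin α) ℂ)
    (P : Matrix (Fin α) (Fin (p.degreeOf 0 * α)) (MvPolynomial (Fin 2) ℂ))
    (Q : Matrix (Fin α) (Fin (p.degreeOf 1 * α)) (MvPolynomial (Fin 2) ℂ)) : Prop where
  eq_Q : ∀ x y : diskVariety p,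
    K x y = (1 - x.1.1 * star y.1.1)⁻¹ • (matVal Q x * (matVal Q y).conjTranspose)
  eq_P : ∀ x y : diskVariety p,
    K x y = (1 - x.1.2 * star y.1.2)⁻¹ • (matVal P x * (matVal P y).conjTranspose)
  rank_Q : ∃ x : diskVariety p, (matVal Q x).rank = α
  rank_P : ∃ x : diskVariety p, (matVal P x).rank = α

/-- A rank `α` admissible kernel over `Z(p) ∩ 𝔻²`. -/
structure AdmissibleKernel (p : MvPolynomial (Fin 2) ℂ) (α : ℕ) where
  /-- The `α × α` matrix-valued kernel function. -/
  ker : diskVariety p → diskVariety p → Matrix (Fin α) (Fin α) ℂ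
  exists_triple : ∃ P Q, IsAdmissibleTriple p α ker P Q

namespace AdmissibleKernel

/-- The kernel with its `α × α` matrix values viewed as operators on the Hilbert space `ℂ^α`. -/
noncomputable def opKernel {p : MvPolynomial (Fin 2) ℂ} {α : ℕ} (K : AdmissibleKernel p α) :
    Matrix (diskVariety p) (diskVariety p)
      (EuclideanSpace ℂ (Fin α) →L[ℂ] EuclideanSpace ℂ (Fin α)) :=
  Matrix.of fun x y => Matrix.toEuclideanCLM (n := Fin α) (𝕜 := ℂ) (K.ker x y)

theorem posSemidef_opKernel {p : MvPolynomial (Fin 2) ℂ} {α : ℕ} (K : AdmissibleKernel p α) :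
    K.opKernel.PosSemidef := by
  obtain ⟨P, Q, h⟩ := K.exists_triple
  have tfae := RKHS.posSemidef_tfae (𝕜 := ℂ) (K := K.opKernel)
  refine (tfae.out 0 2 rfl rfl).mpr ?_
  refine ⟨?_, fun vv => ?_⟩
  · ext1 x y
    simp only [Matrix.conjTranspose_apply, opKernel, Matrix.of_apply]
    rw [← map_star, h.eq_Q y x, h.eq_Q x y, Matrix.star_eq_conjTranspose,
      Matrix.conjTranspose_smul, Matrix.conjTranspose_mul, Matrix.conjTranspose_conjTranspose]
    congr 2
    simp [mul_comm]
  · -- the columns `Q(x)^* γ`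
    let u : diskVariety p → EuclideanSpace ℂ (Fin α) →
        EuclideanSpace ℂ (Fin (p.degreeOf 1 * α)) :=
      fun x v => WithLp.toLp 2 ((matVal Q x).conjTranspose.mulVec v.ofLp)
    have key : ∀ (x x' : diskVariety p) (w w' : EuclideanSpace ℂ (Fin α)),
        HasSum (fun n : ℕ => inner ℂ ((star x.1.1) ^ n • u x w) ((star x'.1.1) ^ n • u x' w'))
          (inner ℂ (K.opKernel x' x w) w') := by
      intro x x' w w'
      have hn : ‖x.1.1 * star x'.1.1‖ < 1 := by
        rw [norm_mul, norm_star]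
        exact mul_lt_one_of_nonneg_of_lt_one_left (norm_nonneg _) x.2.1 x'.2.1.le
      have e : inner ℂ (K.opKernel x' x w) w' =
          (1 - x.1.1 * star x'.1.1)⁻¹ * inner ℂ (u x w) (u x' w') := by
        simp only [opKernel, Matrix.of_apply, h.eq_Q, map_smul,
          smul_apply, inner_smul_left]
        congr 1
        · simp [mul_comm]
        · simp only [u, EuclideanSpace.inner_eq_star_dotProduct, Matrix.ofLp_toEuclideanCLM,
            ← Matrix.mulVec_mulVec, Matrix.star_mulVec, Matrix.conjTranspose_conjTranspose]
          rw [dotProduct_comm, ← Matrix.dotProduct_mulVec, dotProduct_comm]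
      rw [e]
      refine ((hasSum_geometric_of_norm_lt_one hn).mul_right _).congr_fun ?_
      intro n
      simp [mul_pow]
      ring
    have hs : HasSum (fun n : ℕ => vv.sum fun x w => vv.sum fun x' w' =>
        inner ℂ ((star x.1.1) ^ n • u x w) ((star x'.1.1) ^ n • u x' w'))
        (vv.sum fun x w => vv.sum fun x' w' => inner ℂ (K.opKernel x' x w) w') :=
      hasSum_sum fun x _ => hasSum_sum fun x' _ => key x x' _ _
    refine (Complex.hasSum_re hs).nonneg fun n => ?_
    have : (vv.sum fun x w => vv.sum fun x' w' =>
        inner ℂ ((star x.1.1) ^ n • u x w) ((star x'.1.1) ^ n • u x' w')) =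
        inner ℂ (vv.sum fun x w => (star x.1.1) ^ n • u x w)
          (vv.sum fun x w => (star x.1.1) ^ n • u x w) := by
      simp only [Finsupp.sum, sum_inner, inner_sum]
      exact Finset.sum_comm
    rw [this]
    exact inner_self_nonneg (𝕜 := ℂ)

instance {p : MvPolynomial (Fin 2) ℂ} {α : ℕ} (K : AdmissibleKernel p α) :
    Fact K.opKernel.PosSemidef :=
  ⟨K.posSemidef_opKernel⟩

/-- The reproducing kernel Hilbert space `H²(K)` of `ℂ^α`-valued functions on `Z(p) ∩ 𝔻²`. -/
abbrev H2 {p : MvPolynomial (Fin 2) ℂ} {α : ℕ} (K : AdmissibleKernel p α) : Type :=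
  RKHS.OfKernel K.opKernel

end AdmissibleKernel

/-- `M` is the operator of multiplication by `φ` on `H²(K)`. -/
def IsMulOperator {p : MvPolynomial (Fin 2) ℂ} {α : ℕ} (K : AdmissibleKernel p α)
    (φ : ℂ × ℂ → ℂ) (M : K.H2 →L[ℂ] K.H2) : Prop :=
  ∀ (f : K.H2) (x : diskVariety p), (M f) x = φ x.1 • f x

/-- `q ↦ q(S, T)`: the linear map taking the monomial `zⁱ wʲ` to `Sⁱ Tʲ`
(it is used for commuting `S` and `T`). -/
noncomputable def polyOp {H : Type*} [NormedAddCommGroup H] [InnerProductSpace ℂ H]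
    (S T : H →L[ℂ] H) : MvPolynomial (Fin 2) ℂ →ₗ[ℂ] (H →L[ℂ] H) :=
  (MvPolynomial.basisMonomials (Fin 2) ℂ).constr ℂ fun d => S ^ d 0 * T ^ d 1

/-- A pure isometry: an isometry `V` with `⋂ⱼ Vʲ H = 0`. -/
def IsPureIsometry {H : Type*} [NormedAddCommGroup H] [InnerProductSpace ℂ H]
    (V : H →L[ℂ] H) : Prop :=
  Isometry V ∧ ⋂ j : ℕ, Set.range (V ^ j : H →L[ℂ] H) = {0}

/-- A pure (algebraic) isopair: a pair of commuting pure isometries annihilated by a nonzero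
polynomial. -/
structure IsPureIsopair {H : Type*} [NormedAddCommGroup H] [InnerProductSpace ℂ H]
    (S T : H →L[ℂ] H) : Prop where
  comm : Commute S T
  pure_left : IsPureIsometry S
  pure_right : IsPureIsometry T
  algebraic : ∃ q : MvPolynomial (Fin 2) ℂ, q ≠ 0 ∧ polyOp S T q = 0

/-- The subspace `{∑ⱼ qⱼ(S, T) fⱼ : qⱼ ∈ ℂ[z, w]}`. -/
def cyclicSubspace {H : Type*} [NormedAddCommGroup H] [InnerProductSpace ℂ H]
    (S T : H →L[ℂ] H) {k : ℕ} (f : Fin k → H) : Submodule ℂ H where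
  carrier := {h | ∃ q : Fin k → MvPolynomial (Fin 2) ℂ, h = ∑ j, polyOp S T (q j) (f j)}
  add_mem' := by
    rintro _ _ ⟨q, rfl⟩ ⟨r, rfl⟩
    exact ⟨q + r, by simp [Finset.sum_add_distrib]⟩
  zero_mem' := ⟨0, by simp⟩
  smul_mem' := by
    rintro c _ ⟨q, rfl⟩
    exact ⟨c • q, by simp [Finset.smul_sum]⟩

/-- The closure of `{∑ⱼ qⱼ(S, T) fⱼ : qⱼ ∈ ℂ[z, w]}` has finite codimension. -/
def IsNearlyCyclicFamily {H : Type*} [NormedAddCommGroup H] [InnerProductSpace ℂ H]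
    (S T : H →L[ℂ] H) {k : ℕ} (f : Fin k → H) : Prop :=
  FiniteDimensional ℂ (H ⧸ (cyclicSubspace S T f).topologicalClosure)

/-- `(S, T)` is a nearly `α`-cyclic isopair: some `α` vectors generate a subspace whose closure has
finite codimension, and no smaller number of vectors suffices. -/
structure IsNearlyCyclic {H : Type*} [NormedAddCommGroup H] [InnerProductSpace ℂ H]
    (α : ℕ) (S T : H →L[ℂ] H) : Prop where
  isopair : IsPureIsopair S T
  exists_family : ∃ f : Fin α → H, IsNearlyCyclicFamily S T f
  minimal : ∀ k < α, ∀ f : Fin k → H, ¬ IsNearlyCyclicFamily S T f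

/-! Write `k_x v` for the kernel functions. The identity `(1 - z ζ̄) K = Q Q*` says that the
backward shift `A : k_x v ↦ z̄ k_x v` and `B : k_x v ↦ Q(x)* v` satisfy `A* A + B* B = 1`, and `Aʲ →
0` strongly. So `A` is a contraction, `S = A*` is bounded and multiplies by `z`, and every `h`
equals `∑ A*ʲ B* (B Aʲ h)`. The identity with `P` gives `T` in the same way.

That `S` is isometric, i.e. `A A* = 1`, comes from a dimension count. Over all but finitely many `z`
in the disk the variety has `m` points where `Q` has full rank. Their kernel functions span an
`mα`-dimensional space of eigenvectors of `A`, independence coming from the distinct values of `w`.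
On it `B` is injective, hence onto `ℂ^(mα)`. Pairing with such eigenvectors turns a relation `∑ A*ʲ
B* cⱼ = 0` into `∑ zʲ cⱼ = 0` for these `z`, so bounded coefficients are unique; comparing two
expansions of `A* h` gives `A A* h = h` (`IsPureColumn.apply_adjoint`). Purity follows from the
bound on point evaluations, and `p(S, T) = 0` because `p` vanishes on the variety.

For cyclicity, take `α` columns of `Q` with a minor `δ` not identically zero on the variety. By
Cramer's rule they generate `δ` times every column of `Q`, and elimination replaces `δ` by some
nonzero `r(z)`. The orthogonal complement then lies in the kernel of a nonzero polynomial in `A`,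
which is finite-dimensional. Conversely, the values of fewer than `α` generators never span `ℂ^α`,
so over infinitely many `z` some nonzero `k_x v` is orthogonal to everything generated; these are
eigenvectors of `A` with distinct eigenvalues. -/

open Filter Topology InnerProductSpace in
theorem eq_zero_of_frequently_tsum_pow_smul_eq_zero {W : Type*} [NormedAddCommGroup W]
    [NormedSpace ℂ W] [CompleteSpace W] {c : ℕ → W} {C : ℝ} (hc : ∀ j, ‖c j‖ ≤ C)
    (h : ∃ᶠ z in 𝓝[≠] (0 : ℂ), ∑' j, z ^ j • c j = 0) : c = 0 := by
  set p : FormalMultilinearSeries ℂ ℂ W :=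
    fun n => ContinuousMultilinearMap.mkPiRing ℂ (Fin n) (c n) with hp
  have hcoeff : ∀ n, p.coeff n = c n := fun n => by
    simp [FormalMultilinearSeries.coeff, hp]
  have hs : ∀ z : ℂ, ‖z‖ < 1 → Summable fun j => z ^ j • c j := by
    intro z hz
    refine Summable.of_norm_bounded (g := fun j => ‖z‖ ^ j * C)
      ((summable_geometric_of_lt_one (norm_nonneg _) hz).mul_right _) fun j => ?_
    rw [norm_smul, norm_pow]
    exact mul_le_mul_of_nonneg_left (hc j) (by positivity)
  have hf : HasFPowerSeriesAt (fun z : ℂ => ∑' j, z ^ j • c j) p 0 := by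
    rw [hasFPowerSeriesAt_iff]
    filter_upwards [Metric.ball_mem_nhds (0 : ℂ) one_pos] with z hz
    simp only [hcoeff, zero_add]
    exact (hs z (by simpa using hz)).hasSum
  have h0 := hf.analyticAt.frequently_zero_iff_eventually_zero.1 h
  have hp0 : p = 0 := (hf.congr h0).eq_zero
  funext n
  rw [← hcoeff, hp0]
  rfl

/-! ### Pure isometric columns and their observations `B Aʲ h` -/

section Coisometric

open Filter Topology ContinuousLinearMap
open scoped InnerProductSpace

variable {H : Type*} [NormedAddCommGroup H] [InnerProductSpace ℂ H] [CompleteSpace H]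
variable {W : Type*} [NormedAddCommGroup W] [InnerProductSpace ℂ W] [CompleteSpace W]

theorem _root_.ContinuousLinearMap.adjoint_pow (A : H →L[ℂ] H) (j : ℕ) :
    adjoint A ^ j = adjoint (A ^ j) := by
  simpa only [star_eq_adjoint] using (star_pow A j).symm

/-- `(A, B)` is a pure isometric column: `A* A + B* B = 1` and `Aʲ → 0` strongly. -/
structure IsPureColumn (A : H →L[ℂ] H) (B : H →L[ℂ] W) : Prop where
  add_eq : ∀ h, (adjoint A) (A h) + (adjoint B) (B h) = h
  tendsto : ∀ h, Tendsto (fun j : ℕ => (A ^ j) h) atTop (𝓝 0)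

namespace IsPureColumn

variable {A : H →L[ℂ] H} {B : H →L[ℂ] W}

theorem norm_sq_add (hAB : IsPureColumn A B) (h : H) : ‖A h‖ ^ 2 + ‖B h‖ ^ 2 = ‖h‖ ^ 2 := by
  have e : ⟪A h, A h⟫_ℂ + ⟪B h, B h⟫_ℂ = ⟪h, h⟫_ℂ := by
    rw [← adjoint_inner_right, ← adjoint_inner_right, ← inner_add_right, hAB.add_eq]
  simp only [inner_self_eq_norm_sq_to_K] at e
  exact_mod_cast e

theorem norm_apply_le (hAB : IsPureColumn A B) (h : H) : ‖A h‖ ≤ ‖h‖ := by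
  have := hAB.norm_sq_add h
  exact le_of_sq_le_sq (by nlinarith [sq_nonneg ‖B h‖]) (norm_nonneg _)

theorem norm_apply_le' (hAB : IsPureColumn A B) (h : H) : ‖B h‖ ≤ ‖h‖ := by
  have := hAB.norm_sq_add h
  exact le_of_sq_le_sq (by nlinarith [sq_nonneg ‖A h‖]) (norm_nonneg _)

theorem norm_pow_apply_le (hAB : IsPureColumn A B) (j : ℕ) (h : H) : ‖(A ^ j) h‖ ≤ ‖h‖ := by
  induction j with
  | zero => simp
  | succ j ih =>
    rw [pow_succ', mul_apply_eq_comp]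
    exact (hAB.norm_apply_le _).trans ih

theorem norm_adjoint_pow_apply_le (hAB : IsPureColumn A B) (j : ℕ) (h : H) :
    ‖((adjoint A) ^ j) h‖ ≤ ‖h‖ := by
  have e := A.adjoint_pow j
  have hn : ‖A ^ j‖ ≤ 1 := opNorm_le_bound _ zero_le_one fun x => by
    simpa using hAB.norm_pow_apply_le j x
  calc ‖((adjoint A) ^ j) h‖ ≤ ‖(adjoint A) ^ j‖ * ‖h‖ := le_opNorm _ _
    _ ≤ 1 * ‖h‖ := by
      rw [e, LinearIsometryEquiv.norm_map]
      gcongr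
    _ = ‖h‖ := one_mul _

/-- A vector is determined by its observations `B Aʲ h`. -/
theorem eq_zero (hAB : IsPureColumn A B) {h : H} (hB : ∀ j, B ((A ^ j) h) = 0) : h = 0 := by
  -- With no observation, `A` loses no norm along the orbit of `h`, although the orbit tends to
  -- zero.
  have hn : ∀ j, ‖(A ^ j) h‖ = ‖h‖ := by
    intro j
    induction j with
    | zero => simp
    | succ j ih =>
      rw [pow_succ', mul_apply_eq_comp, ← ih]
      have := hAB.norm_sq_add ((A ^ j) h)
      rw [hB, norm_zero] at this
      exact (sq_eq_sq₀ (norm_nonneg _) (norm_nonneg _)).1 (by linarith)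
  have := (hAB.tendsto h).norm
  simp only [hn, norm_zero] at this
  exact norm_eq_zero.1 (tendsto_nhds_unique tendsto_const_nhds this)

/-- All observations of an eigenvector are multiples of `B h`; hence `B` is injective on each
eigenspace of `A`. -/
theorem eq_zero_of_eigenvector (hAB : IsPureColumn A B) {h : H} {μ : ℂ} (hA : A h = μ • h)
    (hB : B h = 0) : h = 0 := by
  refine hAB.eq_zero fun j => ?_
  have : (A ^ j) h = μ ^ j • h := by
    induction j with
    | zero => simp
    | succ j ih => rw [pow_succ', mul_apply_eq_comp, ih, map_smul, hA, smul_smul, pow_succ]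
  rw [this, map_smul, hB, smul_zero]

/-- Iterates `A* A + B* B = 1`; purity then removes the remainder and leaves a series that
reconstructs `h`. -/
theorem sum_add (hAB : IsPureColumn A B) (h : H) (J : ℕ) :
    ∑ j ∈ Finset.range J, ((adjoint A) ^ j) ((adjoint B) (B ((A ^ j) h))) +
      ((adjoint A) ^ J) ((A ^ J) h) = h := by
  induction J with
  | zero => simp
  | succ J ih =>
    rw [Finset.sum_range_succ, add_assoc]
    nth_rewrite 4 [← ih]
    congr 1
    rw [pow_succ, pow_succ', mul_apply_eq_comp, mul_apply_eq_comp, ← map_add, add_comm, hAB.add_eq]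

theorem tendsto_sum (hAB : IsPureColumn A B) (h : H) :
    Tendsto (fun J => ∑ j ∈ Finset.range J, ((adjoint A) ^ j) ((adjoint B) (B ((A ^ j) h))))
      atTop (𝓝 h) := by
  have h0 : Tendsto (fun J : ℕ => ((adjoint A) ^ J) ((A ^ J) h)) atTop (𝓝 0) :=
    squeeze_zero_norm (fun J => hAB.norm_adjoint_pow_apply_le J _)
      (by simpa using (hAB.tendsto h).norm)
  have := h0.const_sub h
  rw [sub_zero] at this
  refine this.congr fun J => ?_
  rw [sub_eq_iff_eq_add]
  exact (hAB.sum_add h J).symm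

/-- Pairing with an eigenvector turns the operator series `∑ A*ʲ B* cⱼ` into a power series in `μ`.
-/
theorem inner_eigenvector_pow {v : H} {μ : ℂ} (hv : A v = star μ • v) (j : ℕ) (w : W) :
    ⟪v, ((adjoint A) ^ j) ((adjoint B) w)⟫_ℂ = μ ^ j * ⟪B v, w⟫_ℂ := by
  induction j with
  | zero => simp [adjoint_inner_right]
  | succ j ih =>
    rw [pow_succ', mul_apply_eq_comp, adjoint_inner_right, hv, inner_smul_left, ih]
    simp [pow_succ']
    ring

/-- If the eigenvectors of `A` are sufficiently many, then `A` is a coisometry. -/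
theorem apply_adjoint (hAB : IsPureColumn A B) {s : Set ℂ} (hs : s.Finite)
    (hev : ∀ μ : ℂ, ‖μ‖ < 1 → μ ∉ s →
      ∀ w : W, (∀ v, A v = star μ • v → ⟪B v, w⟫_ℂ = 0) → w = 0) (h : H) :
    A ((adjoint A) h) = h := by
  -- The difference of two coefficient sequences for `A* h`: its own observations, and those of `h`
  -- shifted by one place.
  let c : ℕ → W := fun j => B ((A ^ j) ((adjoint A) h)) - if j = 0 then 0 else B ((A ^ (j - 1)) h)
  have hbd : ∀ j, ‖c j‖ ≤ ‖(adjoint A) h‖ + ‖h‖ := by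
    intro j
    refine (norm_sub_le _ _).trans (add_le_add ?_ ?_)
    · exact (hAB.norm_apply_le' _).trans (hAB.norm_pow_apply_le _ _)
    · split_ifs
      · simp
      · exact (hAB.norm_apply_le' _).trans (hAB.norm_pow_apply_le _ _)
  have hlim : Tendsto (fun J => ∑ j ∈ Finset.range (J + 1),
      ((adjoint A) ^ j) ((adjoint B) (c j))) atTop (𝓝 0) := by
    have h1 := (tendsto_add_atTop_iff_nat 1).2 (hAB.tendsto_sum ((adjoint A) h))
    have h2 := ((adjoint A).continuous.tendsto _).comp (hAB.tendsto_sum h)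
    have h3 := h1.sub h2
    rw [sub_self] at h3
    refine h3.congr fun J => ?_
    simp only [c, map_sub, Finset.sum_sub_distrib]
    congr 1
    rw [Finset.sum_range_succ' _ J]
    simp [pow_succ', mul_apply_eq_comp]
  have hc : c = 0 := by
    refine eq_zero_of_frequently_tsum_pow_smul_eq_zero hbd (Eventually.frequently ?_)
    have hsc : ∀ᶠ z in 𝓝[≠] (0 : ℂ), z ∉ s := by
      -- The point `0` may lie in `s`, but the punctured neighbourhood omits it anyway.
      have : (s \ {0})ᶜ ∈ 𝓝 (0 : ℂ) := (hs.subset Set.sdiff_subset).isClosed.isOpen_compl.mem_nhds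
        (by simp)
      filter_upwards [mem_nhdsWithin_of_mem_nhds this, self_mem_nhdsWithin] with z hz hz0 hzs
      exact hz ⟨hzs, hz0⟩
    filter_upwards [hsc, mem_nhdsWithin_of_mem_nhds (Metric.ball_mem_nhds (0 : ℂ) one_pos)]
      with z hz hz1
    replace hz1 : ‖z‖ < 1 := by simpa using hz1
    have hsum : Summable fun j => z ^ j • c j := by
      refine Summable.of_norm_bounded (g := fun j => ‖z‖ ^ j * (‖(adjoint A) h‖ + ‖h‖))
        ((summable_geometric_of_lt_one (norm_nonneg _) hz1).mul_right _) fun j => ?_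
      rw [norm_smul, norm_pow]
      exact mul_le_mul_of_nonneg_left (hbd j) (by positivity)
    refine hev z hz1 hz _ fun v hv => ?_
    have t1 := (tendsto_add_atTop_iff_nat 1).2
      (((innerSL ℂ (B v)).hasSum hsum.hasSum).tendsto_sum_nat)
    have t2 := ((innerSL ℂ v).continuous.tendsto 0).comp hlim
    simp only [map_zero] at t2
    refine tendsto_nhds_unique t1 (t2.congr fun J => ?_)
    simp only [Function.comp, innerSL_apply_apply, inner_sum, inner_smul_right,
      inner_eigenvector_pow hv]
  have : A ((adjoint A) h) - h = 0 := by
    refine hAB.eq_zero fun j => ?_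
    -- The coefficient of index `j + 1` reads `B Aʲ (A A* h) = B Aʲ h`.
    have := congrFun hc (j + 1)
    simpa [c, pow_succ, mul_apply_eq_comp] using this
  exact sub_eq_zero.1 this

/-- On the kernel of `r(A)`, reducing `Xʲ` modulo `r` expresses every observation through the first
`deg r` ones, and these determine the vector. -/
theorem finiteDimensional_ker_aeval [FiniteDimensional ℂ W] (hAB : IsPureColumn A B)
    {r : Polynomial ℂ} (hr : r ≠ 0) :
    FiniteDimensional ℂ (LinearMap.ker (Polynomial.aeval A r).toLinearMap) := by
  let L : LinearMap.ker (Polynomial.aeval A r).toLinearMap →ₗ[ℂ] (Fin r.natDegree → W) :=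
    LinearMap.pi fun j => (B ∘L (A ^ (j : ℕ))).toLinearMap ∘ₗ Submodule.subtype _
  refine Module.Finite.of_injective L ((injective_iff_map_eq_zero L).2 ?_)
  rintro ⟨h, hh⟩ hL
  have hL' : ∀ j < r.natDegree, B ((A ^ j) h) = 0 := fun j hj => congrFun hL ⟨j, hj⟩
  have hh' : (Polynomial.aeval A r) h = 0 := hh
  refine Subtype.ext (hAB.eq_zero fun j => ?_)
  have e : (A ^ j) h = Polynomial.aeval A (Polynomial.X ^ j % r) h := by
    have := congrArg (fun q => Polynomial.aeval A q h)
      (EuclideanDomain.mod_add_div (Polynomial.X ^ j) r)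
    simp only [mul_comm r, map_add, map_mul, add_apply, mul_apply_eq_comp] at this
    simpa [hh'] using this.symm
  show B ((A ^ j) h) = 0
  rw [e, Polynomial.aeval_eq_sum_range]
  simp only [sum_apply, smul_apply, map_sum, map_smul]
  refine Finset.sum_eq_zero fun i hi => ?_
  by_cases hr0 : Polynomial.X ^ j % r = 0
  · simp [hr0]
  · rw [hL' i, smul_zero]
    have h1 := Polynomial.natDegree_lt_natDegree hr0 (EuclideanDomain.mod_lt (Polynomial.X ^ j) hr)
    have h2 := Finset.mem_range.1 hi
    omega

theorem _root_.ContinuousLinearMap.inner_aeval_adjoint (A : H →L[ℂ] H) (r : Polynomial ℂ)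
    (g h : H) : ⟪Polynomial.aeval (adjoint A) r g, h⟫_ℂ =
      ⟪g, Polynomial.aeval A (r.map (starRingEnd ℂ)) h⟫_ℂ := by
  induction r using Polynomial.induction_on' with
  | add p q hp hq => simp [hp, hq]
  | monomial n a =>
    have e := A.adjoint_pow n
    simp [Polynomial.aeval_monomial, Algebra.algebraMap_eq_smul_one, e,
      adjoint_inner_left, mul_comm]

/-- For `h ⟂ M`, moving operators across the inner product shows that all observations of `r̄(A) h`
vanish, where `r̄` has conjugated coefficients. So `Mᗮ` lies in the finite-dimensional kernel of
`r̄(A)`. -/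
theorem finiteDimensional_quotient [FiniteDimensional ℂ W] (hAB : IsPureColumn A B)
    {r : Polynomial ℂ} (hr : r ≠ 0) {M : Submodule ℂ H}
    (hM : ∀ (j : ℕ) (w : W), Polynomial.aeval (adjoint A) r (((adjoint A) ^ j) ((adjoint B) w)) ∈ M) :
    FiniteDimensional ℂ (H ⧸ M.topologicalClosure) := by
  have hle : Mᗮ ≤ LinearMap.ker
      (Polynomial.aeval A (r.map (starRingEnd ℂ))).toLinearMap := by
    intro h hh
    refine hAB.eq_zero fun j => ext_inner_left ℂ fun w => ?_
    rw [inner_zero_right, ← adjoint_inner_left, ← adjoint_inner_left, ← A.adjoint_pow]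
    exact (ContinuousLinearMap.inner_aeval_adjoint A r _ h).symm.trans
      (Submodule.inner_right_of_mem_orthogonal (hM j w) hh)
  have := hAB.finiteDimensional_ker_aeval (r := r.map (starRingEnd ℂ))
    (by rwa [Ne, Polynomial.map_eq_zero])
  have : FiniteDimensional ℂ Mᗮ := Submodule.finiteDimensional_of_le hle
  have : FiniteDimensional ℂ M.topologicalClosureᗮ := by
    rwa [Submodule.orthogonal_closure]
  have : CompleteSpace M.topologicalClosure :=
    M.isClosed_topologicalClosure.completeSpace_coe
  exact (Submodule.quotientEquivOfIsCompl _ _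
    (Submodule.isCompl_orthogonal
      (K := M.topologicalClosure))).symm.finiteDimensional

end IsPureColumn

theorem Submodule.finiteDimensional_orthogonal {M : Submodule ℂ H}
    [FiniteDimensional ℂ (H ⧸ M.topologicalClosure)] : FiniteDimensional ℂ Mᗮ := by
  have : CompleteSpace M.topologicalClosure :=
    M.isClosed_topologicalClosure.completeSpace_coe
  rw [← Submodule.orthogonal_closure]
  exact (Submodule.quotientEquivOfIsCompl _ _
    (Submodule.isCompl_orthogonal
      (K := M.topologicalClosure))).finiteDimensional

end Coisometric

/-! ### From kernel identities to multiplication operators -/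

section MultiplicationOperators

open Filter Topology ContinuousLinearMap
open scoped InnerProductSpace

variable {X V H W : Type*}
variable [NormedAddCommGroup V] [InnerProductSpace ℂ V] [CompleteSpace V]
variable [NormedAddCommGroup H] [InnerProductSpace ℂ H] [CompleteSpace H] [RKHS ℂ H X V]
variable [NormedAddCommGroup W] [InnerProductSpace ℂ W] [CompleteSpace W]

theorem RKHS.denseRange_lsum_kerFun :
    DenseRange (Finsupp.lsum ℂ fun x : X => (RKHS.kerFun H x).toLinearMap) := by
  have h := RKHS.kerFun_dense (𝕜 := ℂ) (X := X) (V := V) H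
  have h2 : Submodule.span ℂ {RKHS.kerFun H x v | (x : X) (v : V)} ≤
      LinearMap.range (Finsupp.lsum ℂ fun x : X => (RKHS.kerFun H x).toLinearMap) := by
    rw [Submodule.span_le]
    rintro _ ⟨x, v, rfl⟩
    exact ⟨Finsupp.single x v, by simp⟩
  have h3 := Submodule.topologicalClosure_mono h2
  rw [h, top_le_iff] at h3
  intro f
  have : f ∈ (LinearMap.range
    (Finsupp.lsum ℂ fun x : X => (RKHS.kerFun H x).toLinearMap)).topologicalClosure := by
    rw [h3]; trivial
  rwa [← SetLike.mem_coe, Submodule.topologicalClosure_coe, LinearMap.coe_range] at this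

/-- If `(1 - a(x) a(y)*) K(x, y) = G(x) G(y)*` then the backward shift `k_x v ↦ a(x)* k_x v` and the
map `k_x v ↦ G(x)* v` form a pure isometric column. -/
theorem RKHS.exists_isPureColumn (a : X → ℂ) (ha : ∀ x, ‖a x‖ < 1) (G : X → W →L[ℂ] V)
    (hK : ∀ x y : X, (1 - a x * star (a y)) • RKHS.kernel H x y = G x ∘L adjoint (G y)) :
    ∃ (A : H →L[ℂ] H) (B : H →L[ℂ] W), IsPureColumn A B ∧
      (∀ x v, A (RKHS.kerFun H x v) = star (a x) • RKHS.kerFun H x v) ∧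
      ∀ x v, B (RKHS.kerFun H x v) = adjoint (G x) v := by
  let e := Finsupp.lsum ℂ fun x : X => (RKHS.kerFun H x).toLinearMap
  let fA := Finsupp.lsum ℂ fun x : X => (star (a x) • RKHS.kerFun H x).toLinearMap
  let fB := Finsupp.lsum ℂ fun x : X => (adjoint (G x)).toLinearMap
  have he : DenseRange e := RKHS.denseRange_lsum_kerFun
  have hes : ∀ x v, e (Finsupp.single x v) = RKHS.kerFun H x v := fun x v => by simp [e]
  have hAs : ∀ x v, fA (Finsupp.single x v) = star (a x) • RKHS.kerFun H x v :=
    fun x v => by simp [fA]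
  have hBs : ∀ x v, fB (Finsupp.single x v) = adjoint (G x) v := fun x v => by simp [fB]
  -- On single kernel functions this is `hK`. It makes `fA` and `fB` bounded relative to `e`, so
  -- both descend from formal combinations to the dense span of the kernel functions.
  have key : ∀ u v, ⟪fA u, fA v⟫_ℂ + ⟪fB u, fB v⟫_ℂ = ⟪e u, e v⟫_ℂ := by
    intro u v
    induction u using Finsupp.induction_linear with
    | zero => simp
    | add f g hf hg =>
      simp only [map_add, inner_add_left]
      rw [← hf, ← hg]
      ring
    | single x u =>
      induction v using Finsupp.induction_linear with
      | zero => simp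
      | add f g hf hg =>
        simp only [map_add, inner_add_right]
        rw [← hf, ← hg]
        ring
      | single y v =>
        rw [hes, hes, hAs, hAs, hBs, hBs, adjoint_inner_left, ← comp_apply, ← hK x y,
          inner_smul_left, inner_smul_right, RKHS.kerFun_inner, RKHS.kerFun_apply, smul_apply,
          inner_smul_right]
        simp
        ring
  have hnorm : ∀ u, ‖fA u‖ ^ 2 + ‖fB u‖ ^ 2 = ‖e u‖ ^ 2 := by
    intro u
    have := key u u
    simp only [inner_self_eq_norm_sq_to_K] at this
    exact_mod_cast this
  have hA : ∀ u, ‖fA u‖ ≤ 1 * ‖e u‖ := fun u => by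
    rw [one_mul]
    exact le_of_sq_le_sq (by nlinarith [hnorm u, sq_nonneg ‖fB u‖]) (norm_nonneg _)
  have hB : ∀ u, ‖fB u‖ ≤ 1 * ‖e u‖ := fun u => by
    rw [one_mul]
    exact le_of_sq_le_sq (by nlinarith [hnorm u, sq_nonneg ‖fA u‖]) (norm_nonneg _)
  let A := fA.extendOfNorm e
  let B := fB.extendOfNorm e
  have hAe : ∀ u, A (e u) = fA u := fun u => LinearMap.extendOfNorm_eq he ⟨1, hA⟩ u
  have hBe : ∀ u, B (e u) = fB u := fun u => LinearMap.extendOfNorm_eq he ⟨1, hB⟩ u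
  have hAk : ∀ x v, A (RKHS.kerFun H x v) = star (a x) • RKHS.kerFun H x v := fun x v => by
    rw [← hes, hAe, hAs, hes]
  have hBk : ∀ x v, B (RKHS.kerFun H x v) = adjoint (G x) v := fun x v => by
    rw [← hes, hBe, hBs]
  have hAn : ∀ f, ‖A f‖ ≤ ‖f‖ := fun f => by
    simpa using LinearMap.norm_extendOfNorm_apply_le he 1 hA f
  have hAj : ∀ (j : ℕ) f, ‖(A ^ j) f‖ ≤ ‖f‖ := by
    intro j f
    induction j with
    | zero => simp
    | succ j ih =>
      rw [pow_succ', mul_apply_eq_comp]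
      exact (hAn _).trans ih
  refine ⟨A, B, ⟨fun h => ?_, fun h => ?_⟩, hAk, hBk⟩
  · refine he.induction_on (p := fun h => adjoint A (A h) + adjoint B (B h) = h) h
      (isClosed_eq (by fun_prop) (by fun_prop)) fun u => ?_
    refine he.eq_of_inner_left ℂ fun v => ?_
    rw [inner_add_left, adjoint_inner_left, adjoint_inner_left, hAe, hAe, hBe, hBe, key]
  -- The decay is geometric on kernel functions and passes to all vectors by density, the powers of
  -- `A` being contractions.
  · have hker : ∀ u, Tendsto (fun j : ℕ => (A ^ j) (e u)) atTop (𝓝 0) := by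
      intro u
      induction u using Finsupp.induction_linear with
      | zero => simp
      | add f g hf hg => simpa using hf.add hg
      | single x v =>
        have e1 : ∀ j : ℕ, (A ^ j) (e (Finsupp.single x v)) =
            star (a x) ^ j • e (Finsupp.single x v) := by
          intro j
          rw [hes]
          induction j with
          | zero => simp
          | succ j ih => rw [pow_succ', mul_apply_eq_comp, ih, map_smul, hAk, smul_smul, pow_succ]
        simp only [e1]
        simpa using (tendsto_pow_atTop_nhds_zero_of_norm_lt_one
          (by simpa using ha x : ‖star (a x)‖ < 1)).smul_const (e (Finsupp.single x v))
    rw [Metric.tendsto_atTop]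
    intro ε hε
    obtain ⟨u, hu⟩ := he.exists_dist_lt h (half_pos hε)
    obtain ⟨N, hN⟩ := Metric.tendsto_atTop.1 (hker u) (ε / 2) (half_pos hε)
    refine ⟨N, fun n hn => ?_⟩
    have h1 := hN n hn
    rw [dist_zero_right] at h1 ⊢
    have h2 : (A ^ n) h = (A ^ n) (h - e u) + (A ^ n) (e u) := by simp
    rw [dist_eq_norm] at hu
    calc ‖(A ^ n) h‖ ≤ ‖(A ^ n) (h - e u)‖ + ‖(A ^ n) (e u)‖ := by
          rw [h2]; exact norm_add_le _ _
      _ < ε / 2 + ε / 2 := add_lt_add ((hAj n _).trans_lt hu) h1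
      _ = ε := add_halves ε

theorem RKHS.adjoint_apply_eq_smul {A : H →L[ℂ] H} {a : X → ℂ}
    (hA : ∀ x v, A (RKHS.kerFun H x v) = star (a x) • RKHS.kerFun H x v) (f : H) (x : X) :
    (adjoint A f) x = a x • f x := by
  refine ext_inner_left ℂ fun v => ?_
  rw [← RKHS.kerFun_inner, adjoint_inner_right, hA, inner_smul_left, RKHS.kerFun_inner,
    inner_smul_right]
  simp

theorem RKHS.adjoint_apply_eq_apply {B : H →L[ℂ] W} {G : X → W →L[ℂ] V}
    (hB : ∀ x v, B (RKHS.kerFun H x v) = adjoint (G x) v) (w : W) (x : X) :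
    (adjoint B w) x = G x w := by
  refine ext_inner_left ℂ fun v => ?_
  rw [← RKHS.kerFun_inner, adjoint_inner_right, hB, adjoint_inner_left]

/-- A multiplication operator that is isometric is a pure isometry when the multiplier has
modulus less than one. -/
theorem RKHS.isPureIsometry_of_apply_eq_smul {S : H →L[ℂ] H} {a : X → ℂ} (ha : ∀ x, ‖a x‖ < 1)
    (hS : ∀ f x, (S f) x = a x • f x) (hiso : Isometry S) : IsPureIsometry S := by
  refine ⟨hiso, Set.Subset.antisymm (fun f hf => ?_) ?_⟩
  · rw [Set.mem_singleton_iff]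
    have hpow : ∀ (j : ℕ) (g : H) x, ((S ^ j) g) x = a x ^ j • g x := by
      intro j g x
      induction j with
      | zero => simp
      | succ j ih => rw [pow_succ', mul_apply_eq_comp, hS, ih, smul_smul, pow_succ']
    have hnorm : ∀ (j : ℕ) (g : H), ‖(S ^ j) g‖ = ‖g‖ := by
      intro j g
      induction j with
      | zero => simp
      | succ j ih =>
        rw [pow_succ', mul_apply_eq_comp, ← ih]
        simpa using hiso.dist_eq ((S ^ j) g) 0
    refine RKHS.ext fun x => ?_
    -- If `f = Sʲ g` then `‖g‖ = ‖f‖`, so evaluation at `x` gains a factor `‖a x‖ ^ j` for every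
    -- `j`.
    have hlim : Tendsto (fun j : ℕ => ‖a x‖ ^ j * (‖f‖ * √‖RKHS.kernel H x x‖)) atTop (𝓝 0) := by
      simpa using (tendsto_pow_atTop_nhds_zero_of_lt_one (norm_nonneg _) (ha x)).mul_const _
    have hle : ‖f x‖ ≤ 0 := by
      refine ge_of_tendsto' hlim fun j => ?_
      obtain ⟨g, hg⟩ := Set.mem_iInter.1 hf j
      rw [← hg, hpow, norm_smul, norm_pow, hnorm]
      exact mul_le_mul_of_nonneg_left (RKHS.norm_apply_le g x) (by positivity)
    simpa using hle
  · rintro _ rfl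
    exact Set.mem_iInter.2 fun j => ⟨0, map_zero _⟩

end MultiplicationOperators

/-! ### Elimination and fibres of the variety -/

section BivariatePolynomials

open Polynomial

/-- By Gauss's lemma `P` stays irreducible over the fraction field and does not divide `Q` there;
clear denominators in a Bézout identity. -/
theorem Polynomial.exists_C_eq_mul_add_mul {R : Type*} [CommRing R] [IsDomain R]
    [IsGCDMonoid R] {P Q : R[X]} (hP : Irreducible P) (hdeg : P.natDegree ≠ 0)
    (hPQ : ¬ P ∣ Q) : ∃ (r : R) (A B : R[X]), r ≠ 0 ∧ C r = A * P + B * Q := by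
  let φ := algebraMap R (FractionRing R)
  have hφ : Function.Injective φ := IsFractionRing.injective R (FractionRing R)
  have hprim : P.IsPrimitive := hP.isPrimitive hdeg
  have hirr : Irreducible (P.map φ) :=
    hprim.irreducible_iff_irreducible_map_fraction_map.1 hP
  have hcop : IsCoprime (P.map φ) (Q.map φ) :=
    hirr.coprime_iff_not_dvd.2 fun h => hPQ (hprim.dvd_of_fraction_map_dvd_fraction_map h)
  obtain ⟨a, b, hab⟩ := hcop
  obtain ⟨c, hc, ha⟩ := IsLocalization.integerNormalization_spec (nonZeroDivisors R) a
  obtain ⟨d, hd, hb⟩ := IsLocalization.integerNormalization_spec (nonZeroDivisors R) b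
  refine ⟨c * d, C d * IsLocalization.integerNormalization (nonZeroDivisors R) a,
    C c * IsLocalization.integerNormalization (nonZeroDivisors R) b,
    mul_ne_zero (nonZeroDivisors.ne_zero hc) (nonZeroDivisors.ne_zero hd), ?_⟩
  apply Polynomial.map_injective φ hφ
  rw [Algebra.smul_def, algebraMap_apply] at ha hb
  simp only [Polynomial.map_add, Polynomial.map_mul, ha, hb, map_C, map_mul, φ]
  linear_combination (C (algebraMap R (FractionRing R) c) *
    C (algebraMap R (FractionRing R) d)) * -hab

/-- For all but finitely many `x`, the irreducible polynomial `P(x, ·)` has `deg P` distinct roots,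
none of which is a root of `Q(x, ·)`. -/
theorem Polynomial.exists_finite_roots {P Q : ℂ[X][X]} (hP : Irreducible P)
    (hdeg : P.natDegree ≠ 0) (hPQ : ¬ P ∣ Q) :
    ∃ s : Set ℂ, s.Finite ∧ ∀ x ∉ s, ∃ t : Finset ℂ, t.card = P.natDegree ∧
      ∀ y ∈ t, P.evalEval x y = 0 ∧ Q.evalEval x y ≠ 0 := by
  have hder : ¬ P ∣ derivative P := fun h => by
    have h0 : derivative P ≠ 0 := fun h0 => hdeg (derivative_eq_zero.1 h0)
    exact absurd (natDegree_le_of_dvd h h0) (not_le.2 (natDegree_derivative_lt hdeg))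
  -- Eliminating against `Q * P'` rules out common zeros with `Q` and multiple roots at once; the
  -- leading coefficient below rules out a drop in degree.
  have hPQ' : ¬ P ∣ Q * derivative P := fun h => (hP.prime.dvd_or_dvd h).elim hPQ hder
  obtain ⟨r, A, B, hr, hrAB⟩ := Polynomial.exists_C_eq_mul_add_mul hP hdeg hPQ'
  have hP0 : P ≠ 0 := hP.ne_zero
  have hrl : r * P.leadingCoeff ≠ 0 := mul_ne_zero hr (leadingCoeff_ne_zero.2 hP0)
  refine ⟨{x | (r * P.leadingCoeff).IsRoot x}, finite_setOfPred_isRoot hrl, fun x hx => ?_⟩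
  have hx1 : r.eval x ≠ 0 ∧ P.leadingCoeff.eval x ≠ 0 := by
    simpa [IsRoot, not_or] using hx
  let f : ℂ[X] := P.map (evalRingHom x)
  have hev : ∀ (S : ℂ[X][X]) y, S.evalEval x y = (S.map (evalRingHom x)).eval y := fun S y => by
    rw [map_evalRingHom_eval]
  have hnd : f.natDegree = P.natDegree := natDegree_map_of_leadingCoeff_ne_zero _ hx1.2
  have hf0 : f ≠ 0 := fun h => hdeg (by rw [← hnd, h, natDegree_zero])
  have hAB : ∀ y, f.eval y = 0 → Q.evalEval x y ≠ 0 ∧ f.derivative.eval y ≠ 0 := by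
    intro y hy
    have h1 := congrArg (fun S => evalEval x y S) hrAB
    simp only [evalEval_C, evalEval_add, evalEval_mul] at h1
    rw [hev P y, hy, mul_zero, zero_add] at h1
    have h2 := h1 ▸ hx1.1
    rw [hev (derivative P), ← derivative_map] at h2
    exact mul_ne_zero_iff.1 (right_ne_zero_of_mul h2)
  have hnodup : f.roots.Nodup := by
    refine Multiset.nodup_iff_count_le_one.2 fun y => ?_
    rw [count_roots, ← not_lt, one_lt_rootMultiplicity_iff_isRoot hf0]
    exact fun h => (hAB y h.1).2 h.2
  refine ⟨f.roots.toFinset, ?_, fun y hy => ?_⟩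
  · rw [Multiset.toFinset_card_of_nodup hnodup, ← hnd]
    exact (IsAlgClosed.splits f).natDegree_eq_card_roots.symm
  · have hy' : f.eval y = 0 := by
      have := (mem_roots hf0).1 (Multiset.mem_toFinset.1 hy)
      exact this
    exact ⟨(hev P y).trans hy', (hAB y hy').1⟩

/-- Polynomials in two variables as polynomials in the first over polynomials in the second. -/
theorem exists_ringEquiv_bivariate_zero : ∃ e : MvPolynomial (Fin 2) ℂ ≃+* ℂ[X][X], ∀ q,
    (e q).natDegree = q.degreeOf 0 ∧ ∀ z w, (e q).evalEval w z = polyVal q z w := by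
  let g : MvPolynomial (Fin 1) ℂ ≃+* ℂ[X] := (MvPolynomial.uniqueAlgEquiv ℂ (Fin 1)).toRingEquiv
  let e := (MvPolynomial.finSuccEquiv ℂ 1).toRingEquiv.trans (Polynomial.mapEquiv g)
  have he : ∀ q, e q = (MvPolynomial.finSuccEquiv ℂ 1 q).map (g : MvPolynomial (Fin 1) ℂ →+* ℂ[X]) :=
    fun q => rfl
  refine ⟨e, fun q => ⟨?_, fun z w => ?_⟩⟩
  · rw [he, natDegree_map_eq_of_injective g.injective, MvPolynomial.natDegree_finSuccEquiv]
  · have : (Polynomial.evalEvalRingHom w z).comp (e : MvPolynomial (Fin 2) ℂ →+* ℂ[X][X]) =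
        MvPolynomial.eval ![z, w] := by
      refine MvPolynomial.ringHom_ext (fun c => ?_) fun i => ?_
      · have h1 : MvPolynomial.finSuccEquiv ℂ 1 (MvPolynomial.C c) = C (MvPolynomial.C c) :=
          (MvPolynomial.finSuccEquiv ℂ 1).commutes c
        have h2 : g (MvPolynomial.C c) = C c :=
          (MvPolynomial.uniqueAlgEquiv ℂ (Fin 1)).commutes c
        simp [he, h1, h2]
      · fin_cases i
        · simp [he, MvPolynomial.finSuccEquiv_X_zero]
        · have h1 : MvPolynomial.finSuccEquiv ℂ 1 (MvPolynomial.X 1) = C (MvPolynomial.X 0) :=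
            MvPolynomial.finSuccEquiv_X_succ (j := 0)
          have h2 : g (MvPolynomial.X 0) = X := MvPolynomial.eval₂_X _ _ _
          simp [he, h1, h2]
    exact congrArg (fun φ => φ q) this

theorem exists_ringEquiv_bivariate_one : ∃ e : MvPolynomial (Fin 2) ℂ ≃+* ℂ[X][X], ∀ q,
    (e q).natDegree = q.degreeOf 1 ∧ ∀ z w, (e q).evalEval z w = polyVal q z w := by
  obtain ⟨e, he⟩ := exists_ringEquiv_bivariate_zero
  refine ⟨(MvPolynomial.renameEquiv ℂ (Equiv.swap (0 : Fin 2) 1)).toRingEquiv.trans e,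
    fun q => ⟨?_, fun z w => ?_⟩⟩
  · change (e (MvPolynomial.rename (Equiv.swap (0 : Fin 2) 1) q)).natDegree = _
    rw [(he _).1]
    conv_lhs => rw [← Equiv.swap_apply_right (0 : Fin 2) 1]
    exact MvPolynomial.degreeOf_rename_of_injective (Equiv.injective _) 1
  · change (e (MvPolynomial.rename (Equiv.swap (0 : Fin 2) 1) q)).evalEval z w = _
    rw [(he _).2, polyVal, polyVal, MvPolynomial.eval_rename]
    congr 2
    funext i
    fin_cases i <;> simp

theorem not_dvd_of_polyVal_ne_zero {p δ : MvPolynomial (Fin 2) ℂ} {z w : ℂ}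
    (hp : polyVal p z w = 0) (hδ : polyVal δ z w ≠ 0) : ¬ p ∣ δ := by
  rintro ⟨a, rfl⟩
  rw [polyVal] at hp hδ
  simp [hp] at hδ

theorem evalEval_const_of_natDegree_eq_zero {P : ℂ[X][X]} (hP : P.natDegree = 0) (x y y' : ℂ) :
    P.evalEval x y = P.evalEval x y' := by
  rw [eq_C_of_natDegree_eq_zero hP, evalEval_C, evalEval_C]

/-- If `p` did not involve `w`, a point of the variety could be moved to `(z, 1)` with `‖z‖ < 1`,
which inner torality forbids. -/
theorem InnerToral.degreeOf_one_ne_zero {p : MvPolynomial (Fin 2) ℂ} (hpt : InnerToral p)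
    (x : diskVariety p) : p.degreeOf 1 ≠ 0 := fun h => by
  obtain ⟨e, he⟩ := exists_ringEquiv_bivariate_one
  obtain ⟨⟨z, w⟩, hz, hw, hzw⟩ := x
  have h2 : polyVal p z 1 = 0 := by
    rw [← hzw, ← (he p).2, ← (he p).2]
    exact evalEval_const_of_natDegree_eq_zero ((he p).1.trans h) _ _ _
  simp only at hz
  rcases hpt z 1 h2 with h | h | h
  · simp at h
  · linarith
  · linarith

theorem InnerToral.degreeOf_zero_ne_zero {p : MvPolynomial (Fin 2) ℂ} (hpt : InnerToral p)
    (x : diskVariety p) : p.degreeOf 0 ≠ 0 := fun h => by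
  obtain ⟨e, he⟩ := exists_ringEquiv_bivariate_zero
  obtain ⟨⟨z, w⟩, hz, hw, hzw⟩ := x
  have h2 : polyVal p 1 w = 0 := by
    rw [← hzw, ← (he p).2, ← (he p).2]
    exact evalEval_const_of_natDegree_eq_zero ((he p).1.trans h) _ _ _
  simp only at hw
  rcases hpt 1 w h2 with h | h | h
  · simp at h
  · linarith
  · linarith

/-- Over all but finitely many `z ∈ 𝔻` lie `deg_w p` points of `Z(p) ∩ 𝔻²` at which `δ` does not
vanish. -/
theorem InnerToral.exists_finite_fiber_fst {p δ : MvPolynomial (Fin 2) ℂ} (hp : Irreducible p)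
    (hpt : InnerToral p) {x : diskVariety p} (hδ : polyVal δ x.1.1 x.1.2 ≠ 0) :
    ∃ s : Set ℂ, s.Finite ∧ ∀ z : ℂ, ‖z‖ < 1 → z ∉ s → ∃ t : Finset ℂ, t.card = p.degreeOf 1 ∧
      ∀ w ∈ t, (z, w) ∈ diskVariety p ∧ polyVal δ z w ≠ 0 := by
  obtain ⟨e, he⟩ := exists_ringEquiv_bivariate_one
  obtain ⟨s, hs, h⟩ := Polynomial.exists_finite_roots (P := e p) (Q := e δ)
    ((MulEquiv.irreducible_iff e).2 hp) ((he p).1 ▸ hpt.degreeOf_one_ne_zero x)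
    (fun h => not_dvd_of_polyVal_ne_zero x.2.2.2 hδ ((map_dvd_iff e).1 h))
  refine ⟨s, hs, fun z hz hzs => ?_⟩
  obtain ⟨t, ht, htw⟩ := h z hzs
  refine ⟨t, ht.trans (he p).1, fun w hw => ?_⟩
  obtain ⟨h1, h2⟩ := htw w hw
  rw [(he _).2] at h1 h2
  refine ⟨⟨hz, ?_, h1⟩, h2⟩
  rcases hpt z w h1 with h | h | h
  · exact h.2
  · linarith
  · linarith

/-- Over all but finitely many `w ∈ 𝔻` lie `deg_z p` points of `Z(p) ∩ 𝔻²` at which `δ` does not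
vanish. -/
theorem InnerToral.exists_finite_fiber_snd {p δ : MvPolynomial (Fin 2) ℂ} (hp : Irreducible p)
    (hpt : InnerToral p) {x : diskVariety p} (hδ : polyVal δ x.1.1 x.1.2 ≠ 0) :
    ∃ s : Set ℂ, s.Finite ∧ ∀ w : ℂ, ‖w‖ < 1 → w ∉ s → ∃ t : Finset ℂ, t.card = p.degreeOf 0 ∧
      ∀ z ∈ t, (z, w) ∈ diskVariety p ∧ polyVal δ z w ≠ 0 := by
  obtain ⟨e, he⟩ := exists_ringEquiv_bivariate_zero
  obtain ⟨s, hs, h⟩ := Polynomial.exists_finite_roots (P := e p) (Q := e δ)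
    ((MulEquiv.irreducible_iff e).2 hp) ((he p).1 ▸ hpt.degreeOf_zero_ne_zero x)
    (fun h => not_dvd_of_polyVal_ne_zero x.2.2.2 hδ ((map_dvd_iff e).1 h))
  refine ⟨s, hs, fun w hw hws => ?_⟩
  obtain ⟨t, ht, htz⟩ := h w hws
  refine ⟨t, ht.trans (he p).1, fun z hz => ?_⟩
  obtain ⟨h1, h2⟩ := htz z hz
  rw [(he _).2] at h1 h2
  refine ⟨⟨?_, hw, h1⟩, h2⟩
  rcases hpt z w h1 with h | h | h
  · exact h.1
  · linarith
  · linarith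

/-- A polynomial that does not vanish identically on the variety divides, on the variety, a nonzero
polynomial in `z`. -/
theorem InnerToral.exists_eval_eq_mul {p δ : MvPolynomial (Fin 2) ℂ} (hp : Irreducible p)
    (hpt : InnerToral p) {x : diskVariety p} (hδ : polyVal δ x.1.1 x.1.2 ≠ 0) :
    ∃ (r : ℂ[X]) (a : MvPolynomial (Fin 2) ℂ), r ≠ 0 ∧ ∀ y : diskVariety p,
      r.eval y.1.1 = polyVal a y.1.1 y.1.2 * polyVal δ y.1.1 y.1.2 := by
  obtain ⟨e, he⟩ := exists_ringEquiv_bivariate_one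
  obtain ⟨r, A, B, hr, h⟩ := Polynomial.exists_C_eq_mul_add_mul (P := e p) (Q := e δ)
    ((MulEquiv.irreducible_iff e).2 hp) ((he p).1 ▸ hpt.degreeOf_one_ne_zero x)
    (fun h => not_dvd_of_polyVal_ne_zero x.2.2.2 hδ ((map_dvd_iff e).1 h))
  refine ⟨r, e.symm B, hr, fun y => ?_⟩
  have h1 := congrArg (fun S => evalEval y.1.1 y.1.2 S) h
  simp only [evalEval_C, evalEval_add, evalEval_mul] at h1
  rw [h1, (he p).2, y.2.2.2, mul_zero, zero_add, (he δ).2, ← (he (e.symm B)).2,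
    RingEquiv.apply_symm_apply]

end BivariatePolynomials

/-! ### Eigenvectors from the points of a fibre -/

section EigenvectorsFromFibers

open ContinuousLinearMap
open scoped InnerProductSpace

variable {X V H W : Type*}
variable [NormedAddCommGroup V] [InnerProductSpace ℂ V] [CompleteSpace V]
variable [NormedAddCommGroup H] [InnerProductSpace ℂ H] [CompleteSpace H] [RKHS ℂ H X V]
variable [NormedAddCommGroup W] [InnerProductSpace ℂ W] [CompleteSpace W]

/-- The summands have distinct eigenvalues, and a Lagrange basis polynomial in `A` isolates each of
them. -/
theorem RKHS.kerFun_eq_zero_of_sum_eq_zero {A : H →L[ℂ] H} {b : X → ℂ}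
    (hA : ∀ x v, A (RKHS.kerFun H x v) = star (b x) • RKHS.kerFun H x v)
    {ι : Type*} [Fintype ι] {x : ι → X} (hb : Function.Injective fun i => b (x i)) {γ : ι → V}
    (hsum : ∑ i, RKHS.kerFun H (x i) (γ i) = 0) (i : ι) : RKHS.kerFun H (x i) (γ i) = 0 := by
  classical
  have haeval : ∀ (q : Polynomial ℂ) x v, Polynomial.aeval A q (RKHS.kerFun H x v) =
      q.eval (star (b x)) • RKHS.kerFun H x v := by
    intro q x v
    have hpow : ∀ n : ℕ, (A ^ n) (RKHS.kerFun H x v) = star (b x) ^ n • RKHS.kerFun H x v := by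
      intro n
      induction n with
      | zero => simp
      | succ n ih => rw [pow_succ', mul_apply_eq_comp, ih, map_smul, hA, smul_smul, pow_succ]
    rw [Polynomial.aeval_eq_sum_range, Polynomial.eval_eq_sum_range, Finset.sum_smul, sum_apply]
    exact Finset.sum_congr rfl fun n _ => by rw [smul_apply, hpow, smul_smul]
  have hinj : Set.InjOn (fun i => star (b (x i))) (Finset.univ : Finset ι) :=
    (star_injective.comp hb).injOn
  have h := congrArg (Polynomial.aeval A (Lagrange.basis Finset.univ (fun i => star (b (x i))) i))
    hsum
  rw [map_zero, map_sum, Finset.sum_eq_single i] at h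
  · rwa [haeval, Lagrange.eval_basis_self hinj (Finset.mem_univ i), one_smul] at h
  · intro j _ hj
    rw [haeval, Lagrange.eval_basis_of_ne (v := fun i => star (b (x i))) hj.symm
      (Finset.mem_univ j), zero_smul]
  · simp

/-- The points share one value of `a` and are separated by `b`. Thus `B` is injective on
combinations of their kernel functions, and by `hdim` it is onto `W`. -/
theorem RKHS.eq_zero_of_inner_eigenvector [FiniteDimensional ℂ V] [FiniteDimensional ℂ W]
    {A A' : H →L[ℂ] H} {B : H →L[ℂ] W} (hAB : IsPureColumn A B) {a b : X → ℂ}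
    (hA : ∀ x v, A (RKHS.kerFun H x v) = star (a x) • RKHS.kerFun H x v)
    (hA' : ∀ x v, A' (RKHS.kerFun H x v) = star (b x) • RKHS.kerFun H x v)
    {ι : Type*} [Fintype ι] {x : ι → X} (hb : Function.Injective fun i => b (x i))
    (hk : ∀ i, Function.Injective (RKHS.kerFun H (x i)))
    (hdim : Module.finrank ℂ W = Fintype.card ι * Module.finrank ℂ V)
    {μ : ℂ} (hμ : ∀ i, a (x i) = μ) {w : W} (hw : ∀ v, A v = star μ • v → ⟪B v, w⟫_ℂ = 0) :
    w = 0 := by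
  let L : (ι → V) →ₗ[ℂ] H := ∑ i, (RKHS.kerFun H (x i)).toLinearMap ∘ₗ LinearMap.proj i
  have hL : ∀ γ, L γ = ∑ i, RKHS.kerFun H (x i) (γ i) := fun γ => by simp [L]
  have hAL : ∀ γ, A (L γ) = star μ • L γ := fun γ => by
    simp only [hL, map_sum, hA, hμ, Finset.smul_sum]
  have hinj : Function.Injective (B.toLinearMap ∘ₗ L) := by
    refine (injective_iff_map_eq_zero _).2 fun γ hγ => ?_
    have h0 := hAB.eq_zero_of_eigenvector (hAL γ) hγ
    rw [hL] at h0
    funext i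
    exact hk i ((RKHS.kerFun_eq_zero_of_sum_eq_zero hA' hb h0 i).trans (map_zero _).symm)
  have hsurj := (LinearMap.injective_iff_surjective_of_finrank_eq_finrank
    (by rw [hdim, Module.finrank_pi_fintype]; simp)).1 hinj
  obtain ⟨γ, rfl⟩ := hsurj w
  exact inner_self_eq_zero.1 (hw _ (hAL γ))

theorem IsPureColumn.isometry_adjoint {A : H →L[ℂ] H} (hA : ∀ h, A (adjoint A h) = h) :
    Isometry (adjoint A) := by
  refine AddMonoidHomClass.isometry_of_norm _ fun h => ?_
  have : ⟪adjoint A h, adjoint A h⟫_ℂ = ⟪h, h⟫_ℂ := by rw [adjoint_inner_left, hA]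
  simp only [inner_self_eq_norm_sq_to_K] at this
  exact (sq_eq_sq₀ (norm_nonneg _) (norm_nonneg _)).1 (by exact_mod_cast this)

/-- A subspace of `H` whose values at points over infinitely many values of `a` do not exhaust `V`
has infinite codimension. -/
theorem RKHS.not_finiteDimensional_quotient {A : H →L[ℂ] H} {a : X → ℂ}
    (hA : ∀ x v, A (RKHS.kerFun H x v) = star (a x) • RKHS.kerFun H x v)
    {s : Set ℂ} (hs : s.Infinite) (M : Submodule ℂ H)
    (h : ∀ μ ∈ s, ∃ x, a x = μ ∧ Function.Injective (RKHS.kerFun H x) ∧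
      ∃ v ≠ (0 : V), ∀ f ∈ M, ⟪v, f x⟫_ℂ = 0) :
    ¬ FiniteDimensional ℂ (H ⧸ M.topologicalClosure) := fun hfin => by
  have hM : FiniteDimensional ℂ Mᗮ := Submodule.finiteDimensional_orthogonal
  choose x hax hx v hv hvM using fun μ : s => h μ μ.2
  let u : s → Mᗮ := fun μ => ⟨RKHS.kerFun H (x μ) (v μ), fun f hf => by
    rw [RKHS.inner_kerFun, inner_eq_zero_symm]
    exact hvM μ f hf⟩
  have hli : LinearIndependent ℂ fun μ => (u μ : H) := by
    refine Module.End.eigenvectors_linearIndependent' A.toLinearMap (fun μ : s => star (μ : ℂ))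
      (star_injective.comp Subtype.val_injective) _ fun μ => ?_
    refine Module.End.hasEigenvector_iff.2 ⟨Module.End.mem_eigenspace_iff.2 ?_, fun h0 => ?_⟩
    · have := hA (x μ) (v μ)
      rwa [hax μ] at this
    · exact hv μ (hx μ (h0.trans (map_zero _).symm))
  have hli' : LinearIndependent ℂ u := hli.of_comp (Submodule.subtype _)
  have : Finite s := hli'.finite
  exact hs (Set.toFinite s)

end EigenvectorsFromFibers

/-! ### Full rank and minors -/

section MatrixRank

theorem Matrix.exists_det_submatrix_ne_zero {a b : ℕ} {M : Matrix (Fin a) (Fin b) ℂ}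
    (hM : M.rank = a) : ∃ c : Fin a → Fin b, (M.submatrix id c).det ≠ 0 := by
  have hr := M.rank_eq_finrank_span_cols
  rw [hM] at hr
  obtain ⟨f, hf, -, hli⟩ := Submodule.exists_fun_fin_finrank_span_eq ℂ (Set.range M.col)
  choose c hc using hf
  refine ⟨c ∘ Fin.cast hr, ?_⟩
  have h : LinearIndependent ℂ (M.submatrix id (c ∘ Fin.cast hr)).col := by
    have e : (M.submatrix id (c ∘ Fin.cast hr)).col = f ∘ Fin.cast hr := by
      funext i
      exact hc _
    rw [e]
    exact hli.comp _ (Fin.cast_injective hr)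
  exact ((Matrix.isUnit_iff_isUnit_det _).1
    (Matrix.linearIndependent_cols_iff_isUnit.1 h)).ne_zero

theorem Matrix.rank_eq_of_det_submatrix_ne_zero {a b : ℕ} {M : Matrix (Fin a) (Fin b) ℂ}
    {c : Fin a → Fin b} (hc : (M.submatrix id c).det ≠ 0) : M.rank = a := by
  refine le_antisymm ((M.rank_le_card_height).trans (by simp)) ?_
  have h := M.rank_submatrix_le id c
  rw [Matrix.rank_of_det_ne_zero hc] at h
  simpa using h

theorem Matrix.mulVec_surjective_of_rank_eq {a b : ℕ} {M : Matrix (Fin a) (Fin b) ℂ}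
    (hM : M.rank = a) : Function.Surjective M.mulVec := by
  have : LinearMap.range M.mulVecLin = ⊤ :=
    Submodule.eq_top_of_finrank_eq (by rw [← Matrix.rank, hM]; simp)
  exact LinearMap.range_eq_top.1 this

/-- Makes full rank at one point a polynomial condition, which then persists on all but finitely
many fibres. -/
theorem det_submatrix_matVal {p : MvPolynomial (Fin 2) ℂ} {a b : ℕ}
    (Q : Matrix (Fin a) (Fin b) (MvPolynomial (Fin 2) ℂ)) (c : Fin a → Fin b)
    (x : diskVariety p) : ((matVal Q x).submatrix id c).det =
      polyVal (Q.submatrix id c).det x.1.1 x.1.2 :=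
  ((MvPolynomial.eval ![x.1.1, x.1.2]).map_det (Q.submatrix id c)).symm

end MatrixRank

/-! ### Admissible kernels, generators and minimality -/

section AdmissibleKernels

open ContinuousLinearMap
open scoped InnerProductSpace Matrix

/-- A rectangular matrix as an operator between Euclidean spaces. -/
noncomputable def Matrix.toEuclideanOp {a b : ℕ} (M : Matrix (Fin a) (Fin b) ℂ) :
    EuclideanSpace ℂ (Fin b) →L[ℂ] EuclideanSpace ℂ (Fin a) :=
  (Matrix.toEuclideanLin M).toContinuousLinearMap

theorem Matrix.ofLp_toEuclideanOp {a b : ℕ} (M : Matrix (Fin a) (Fin b) ℂ)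
    (v : EuclideanSpace ℂ (Fin b)) : (M.toEuclideanOp v).ofLp = M *ᵥ v.ofLp := rfl

theorem Matrix.adjoint_toEuclideanOp {a b : ℕ} (M : Matrix (Fin a) (Fin b) ℂ) :
    adjoint M.toEuclideanOp = Mᴴ.toEuclideanOp := by
  rw [toEuclideanOp, toEuclideanOp, Matrix.toEuclideanLin_conjTranspose_eq_adjoint,
    LinearMap.adjoint_toContinuousLinearMap]

variable {p : MvPolynomial (Fin 2) ℂ} {α : ℕ} (K : AdmissibleKernel p α)

namespace AdmissibleKernel

theorem exists_isPureColumn {N : ℕ} {a : diskVariety p → ℂ} (ha : ∀ x, ‖a x‖ < 1)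
    {R : Matrix (Fin α) (Fin N) (MvPolynomial (Fin 2) ℂ)}
    (hR : ∀ x y, K.ker x y = (1 - a x * star (a y))⁻¹ • (matVal R x * (matVal R y)ᴴ)) :
    ∃ (A : K.H2 →L[ℂ] K.H2) (B : K.H2 →L[ℂ] EuclideanSpace ℂ (Fin N)), IsPureColumn A B ∧
      (∀ x v, A (RKHS.kerFun K.H2 x v) = star (a x) • RKHS.kerFun K.H2 x v) ∧
      ∀ x v, B (RKHS.kerFun K.H2 x v) = adjoint (matVal R x).toEuclideanOp v := by
  refine RKHS.exists_isPureColumn a ha (fun x => (matVal R x).toEuclideanOp) fun x y => ?_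
  have hne : 1 - a x * star (a y) ≠ 0 := fun h => by
    have h1 : ‖a x * star (a y)‖ < 1 := by
      rw [norm_mul, norm_star]
      exact mul_lt_one_of_nonneg_of_lt_one_left (norm_nonneg _) (ha x) (ha y).le
    rw [← sub_eq_zero.1 h, norm_one] at h1
    exact lt_irrefl _ h1
  rw [RKHS.OfKernel.kernel_ofKernel, Matrix.adjoint_toEuclideanOp]
  ext1 v
  refine (WithLp.ofLp_injective 2) ?_
  simp only [opKernel, Matrix.of_apply, hR, map_smul, smul_smul, mul_inv_cancel₀ hne, one_smul,
    comp_apply, Matrix.ofLp_toEuclideanOp, Matrix.ofLp_toEuclideanCLM, Matrix.mulVec_mulVec]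

/-- `B` sends `k_x v` to `R(x)* v`, and `R(x)*` is injective because `R(x)` is onto. -/
theorem kerFun_injective {N : ℕ} {B : K.H2 →L[ℂ] EuclideanSpace ℂ (Fin N)}
    {R : Matrix (Fin α) (Fin N) (MvPolynomial (Fin 2) ℂ)}
    (hB : ∀ x v, B (RKHS.kerFun K.H2 x v) = adjoint (matVal R x).toEuclideanOp v)
    {x : diskVariety p} (hx : (matVal R x).rank = α) :
    Function.Injective (RKHS.kerFun K.H2 x) := by
  refine (injective_iff_map_eq_zero _).2 fun v hv => ?_
  have h0 : adjoint (matVal R x).toEuclideanOp v = 0 := by rw [← hB, hv, map_zero]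
  obtain ⟨w, hw⟩ := Matrix.mulVec_surjective_of_rank_eq hx v.ofLp
  have hw' : (matVal R x).toEuclideanOp (WithLp.toLp 2 w) = v := WithLp.ofLp_injective 2 hw
  rw [← inner_self_eq_zero (𝕜 := ℂ)]
  nth_rewrite 2 [← hw']
  rw [← adjoint_inner_left, h0, inner_zero_left]

/-- The width `N = d * α` matches `d` points per fibre with `α` dimensions each. The roles of `a`
and `b` can be exchanged, so this serves both coordinates. -/
theorem isometry_adjoint {N d : ℕ} (hN : N = d * α) {A A' : K.H2 →L[ℂ] K.H2}
    {B : K.H2 →L[ℂ] EuclideanSpace ℂ (Fin N)} (hAB : IsPureColumn A B) {a b : diskVariety p → ℂ}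
    (hA : ∀ x v, A (RKHS.kerFun K.H2 x v) = star (a x) • RKHS.kerFun K.H2 x v)
    (hA' : ∀ x v, A' (RKHS.kerFun K.H2 x v) = star (b x) • RKHS.kerFun K.H2 x v)
    {s : Set ℂ} (hs : s.Finite)
    (hfib : ∀ μ : ℂ, ‖μ‖ < 1 → μ ∉ s → ∃ t : Finset ℂ, t.card = d ∧
      ∀ ν ∈ t, ∃ x : diskVariety p, a x = μ ∧ b x = ν ∧
        Function.Injective (RKHS.kerFun K.H2 x)) : Isometry (adjoint A) := by
  refine IsPureColumn.isometry_adjoint (hAB.apply_adjoint hs fun μ hμ hμs w hw => ?_)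
  obtain ⟨t, ht, hx⟩ := hfib μ hμ hμs
  choose x hax hbx hx using fun ν : t => hx ν ν.2
  refine RKHS.eq_zero_of_inner_eigenvector hAB hA hA' (x := x) ?_ hx ?_ hax hw
  · simp only [hbx]
    exact Subtype.val_injective
  · simp [hN, ht]

end AdmissibleKernel

section PolyOp

variable {K} {S T : K.H2 →L[ℂ] K.H2}

theorem IsMulOperator.pow_apply {φ : ℂ × ℂ → ℂ} {M : K.H2 →L[ℂ] K.H2} (hM : IsMulOperator K φ M)
    (j : ℕ) (f : K.H2) (x : diskVariety p) : ((M ^ j) f) x = φ x.1 ^ j • f x := by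
  induction j with
  | zero => simp
  | succ j ih => rw [pow_succ', mul_apply_eq_comp, hM, ih, smul_smul, pow_succ']

theorem RKHS.sum_apply' {ι : Type*} (s : Finset ι) (f : ι → K.H2) (x : diskVariety p) :
    (∑ i ∈ s, f i) x = ∑ i ∈ s, f i x := by
  rw [← RKHS.coeCLM_apply, map_sum, Finset.sum_apply]
  rfl

theorem polyOp_apply (hS : IsMulOperator K (fun x => x.1) S)
    (hT : IsMulOperator K (fun x => x.2) T) (q : MvPolynomial (Fin 2) ℂ) (f : K.H2)
    (x : diskVariety p) : (polyOp S T q f) x = polyVal q x.1.1 x.1.2 • f x := by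
  induction q using MvPolynomial.induction_on' with
  | add q r hq hr =>
    rw [map_add, add_apply, RKHS.coe_add, Pi.add_apply, hq, hr, ← add_smul]
    simp [polyVal]
  | monomial d c =>
    have e : polyOp S T (MvPolynomial.monomial d c) = c • (S ^ d 0 * T ^ d 1) := by
      have h1 : MvPolynomial.monomial d c = c • MvPolynomial.basisMonomials (Fin 2) ℂ d := by
        simp [MvPolynomial.smul_monomial]
      rw [h1, map_smul, polyOp, Module.Basis.constr_basis]
    rw [e, smul_apply, RKHS.coe_smul, Pi.smul_apply, mul_apply_eq_comp, hS.pow_apply, hT.pow_apply,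
      smul_smul, smul_smul]
    simp [polyVal, MvPolynomial.eval_monomial, Finsupp.prod_fintype, mul_assoc]

theorem aeval_apply (hS : IsMulOperator K (fun x => x.1) S) (r : Polynomial ℂ) (f : K.H2)
    (x : diskVariety p) : (Polynomial.aeval S r f) x = r.eval x.1.1 • f x := by
  rw [Polynomial.aeval_eq_sum_range, Polynomial.eval_eq_sum_range, Finset.sum_smul,
    sum_apply, RKHS.sum_apply']
  refine Finset.sum_congr rfl fun n _ => ?_
  rw [smul_apply, RKHS.coe_smul, Pi.smul_apply, hS.pow_apply, smul_smul]

theorem sum_polyOp_apply (hS : IsMulOperator K (fun x => x.1) S)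
    (hT : IsMulOperator K (fun x => x.2) T) {k : ℕ} (q : Fin k → MvPolynomial (Fin 2) ℂ)
    (f : Fin k → K.H2) (x : diskVariety p) :
    (∑ j, polyOp S T (q j) (f j)) x = ∑ j, polyVal (q j) x.1.1 x.1.2 • f j x := by
  simp only [RKHS.sum_apply', polyOp_apply hS hT]

end PolyOp

variable {K}

/-- The `α` columns of `Q` selected by a minor not vanishing identically generate a subspace of
finite codimension. -/
theorem isNearlyCyclicFamily_columns (hp : Irreducible p) (hpt : InnerToral p) {N : ℕ}
    {A T : K.H2 →L[ℂ] K.H2} {B : K.H2 →L[ℂ] EuclideanSpace ℂ (Fin N)} (hAB : IsPureColumn A B)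
    {Q : Matrix (Fin α) (Fin N) (MvPolynomial (Fin 2) ℂ)}
    (hB : ∀ w x, (adjoint B w) x = (matVal Q x).toEuclideanOp w)
    (hS : IsMulOperator K (fun x => x.1) (adjoint A)) (hT : IsMulOperator K (fun x => x.2) T)
    {c : Fin α → Fin N} {x₀ : diskVariety p}
    (hc : polyVal (Q.submatrix id c).det x₀.1.1 x₀.1.2 ≠ 0) :
    IsNearlyCyclicFamily (adjoint A) T
      fun l => adjoint B (EuclideanSpace.single (c l) (1 : ℂ)) := by
  obtain ⟨r, a, hr, hra⟩ := hpt.exists_eval_eq_mul hp hc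
  refine hAB.finiteDimensional_quotient hr fun j w => ?_
  -- Cramer's rule: these coefficients express the minor times `Q w` through the chosen columns.
  let q : Fin α → MvPolynomial (Fin 2) ℂ :=
    ((Q.submatrix id c).adjugate * Q) *ᵥ fun i => MvPolynomial.C (w i)
  have hq : (Q.submatrix id c) *ᵥ q =
      (Q.submatrix id c).det • (Q *ᵥ fun i => MvPolynomial.C (w i)) := by
    simp only [q]
    rw [Matrix.mulVec_mulVec, ← Matrix.mul_assoc, Matrix.mul_adjugate, Matrix.smul_mul,
      Matrix.one_mul, Matrix.smul_mulVec]
  -- The factor `a` turns the minor into `r(z)` on the variety, and `X 0 ^ j` accounts for `Sʲ`.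
  refine ⟨fun l => a * MvPolynomial.X 0 ^ j * q l, RKHS.ext fun x => ?_⟩
  rw [sum_polyOp_apply hS hT, aeval_apply hS, hS.pow_apply, hra, hB]
  ext k
  have hqk := congrArg (fun v => polyVal (v k) x.1.1 x.1.2) hq
  simp only [polyVal, Matrix.mulVec, dotProduct, Pi.smul_apply, smul_eq_mul, map_mul, map_sum,
    MvPolynomial.eval_C, Matrix.submatrix_apply, id] at hqk
  simp only [hB, PiLp.smul_apply, smul_eq_mul, WithLp.ofLp_sum, WithLp.ofLp_smul,
    Matrix.ofLp_toEuclideanOp, Finset.sum_apply, Pi.smul_apply, PiLp.ofLp_single,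
    Matrix.mulVec_single_one, Matrix.col_apply, polyVal, map_mul, map_pow, MvPolynomial.eval_X,
    matVal, Matrix.map_apply, Matrix.mulVec, dotProduct]
  rw [mul_assoc (MvPolynomial.eval _ a), mul_left_comm (MvPolynomial.eval _ _) (x.1.1 ^ j), ← hqk,
    Finset.mul_sum, Finset.mul_sum]
  refine Finset.sum_congr rfl fun l _ => ?_
  rw [Matrix.cons_val_zero]
  ring

/-- Fewer than `α` vectors never generate a subspace of finite codimension. -/
theorem not_isNearlyCyclicFamily {A S T : K.H2 →L[ℂ] K.H2}
    (hA : ∀ x v, A (RKHS.kerFun K.H2 x v) = star x.1.1 • RKHS.kerFun K.H2 x v)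
    (hS : IsMulOperator K (fun x => x.1) S) (hT : IsMulOperator K (fun x => x.2) T)
    {s : Set ℂ} (hs : s.Infinite)
    (hinj : ∀ μ ∈ s, ∃ x : diskVariety p, x.1.1 = μ ∧ Function.Injective (RKHS.kerFun K.H2 x))
    {k : ℕ} (hk : k < α) (f : Fin k → K.H2) : ¬ IsNearlyCyclicFamily S T f := by
  refine RKHS.not_finiteDimensional_quotient (A := A) (a := fun x : diskVariety p => x.1.1) hA hs
    (cyclicSubspace S T f) fun μ hμ => ?_
  obtain ⟨x, hx, hxi⟩ := hinj μ hμ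
  refine ⟨x, hx, hxi, ?_⟩
  -- Every generated function takes its value at `x` in `E`, whose dimension is at most `k < α`.
  let E : Submodule ℂ (EuclideanSpace ℂ (Fin α)) := Submodule.span ℂ (Set.range fun j => f j x)
  have hE : E ≠ ⊤ := fun h => by
    have h1 : Module.finrank ℂ E ≤ k :=
      (finrank_range_le_card (R := ℂ) fun j => f j x).trans_eq (Fintype.card_fin k)
    rw [h, finrank_top, finrank_euclideanSpace_fin] at h1
    omega
  obtain ⟨v, hv, hv0⟩ := Submodule.exists_mem_ne_zero_of_ne_bot
    (mt Submodule.orthogonal_eq_bot_iff.1 hE)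
  refine ⟨v, hv0, ?_⟩
  rintro _ ⟨q, rfl⟩
  rw [sum_polyOp_apply hS hT]
  refine Submodule.inner_left_of_mem_orthogonal (K := E) ?_ hv
  exact Submodule.sum_mem _ fun j _ => Submodule.smul_mem _ _ (Submodule.subset_span ⟨j, rfl⟩)

end AdmissibleKernels

/-! ### The two coordinates combined -/

theorem theorem4p7 (p : MvPolynomial (Fin 2) ℂ) (hp : Irreducible p) (hpt : InnerToral p)
    (α : ℕ) (hα : 0 < α) (K : AdmissibleKernel p α) :
    ∃ S T : K.H2 →L[ℂ] K.H2,
      IsMulOperator K (fun x => x.1) S ∧ IsMulOperator K (fun x => x.2) T ∧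
        IsNearlyCyclic α S T := by
  obtain ⟨P, Q, h⟩ := K.exists_triple
  obtain ⟨xQ, hxQ⟩ := h.rank_Q
  obtain ⟨xP, hxP⟩ := h.rank_P
  obtain ⟨cQ, hcQ⟩ := Matrix.exists_det_submatrix_ne_zero hxQ
  obtain ⟨cP, hcP⟩ := Matrix.exists_det_submatrix_ne_zero hxP
  rw [det_submatrix_matVal] at hcQ hcP
  obtain ⟨A, B, hAB, hA, hB⟩ := K.exists_isPureColumn (a := fun x => x.1.1) (fun x => x.2.1) h.eq_Q
  obtain ⟨A', B', hAB', hA', hB'⟩ :=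
    K.exists_isPureColumn (a := fun x => x.1.2) (fun x => x.2.2.1) h.eq_P
  have hS : IsMulOperator K (fun x => x.1) (ContinuousLinearMap.adjoint A) :=
    RKHS.adjoint_apply_eq_smul hA
  have hT : IsMulOperator K (fun x => x.2) (ContinuousLinearMap.adjoint A') :=
    RKHS.adjoint_apply_eq_smul hA'
  have hkQ : ∀ x : diskVariety p, polyVal (Q.submatrix id cQ).det x.1.1 x.1.2 ≠ 0 →
      Function.Injective (RKHS.kerFun K.H2 x) := fun x hx =>
    K.kerFun_injective hB (Matrix.rank_eq_of_det_submatrix_ne_zero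
      (by rwa [det_submatrix_matVal]))
  have hkP : ∀ x : diskVariety p, polyVal (P.submatrix id cP).det x.1.1 x.1.2 ≠ 0 →
      Function.Injective (RKHS.kerFun K.H2 x) := fun x hx =>
    K.kerFun_injective hB' (Matrix.rank_eq_of_det_submatrix_ne_zero
      (by rwa [det_submatrix_matVal]))
  obtain ⟨s, hs, hfib⟩ := hpt.exists_finite_fiber_fst hp hcQ
  obtain ⟨s', hs', hfib'⟩ := hpt.exists_finite_fiber_snd hp hcP
  have hSiso : Isometry (ContinuousLinearMap.adjoint A) := by
    refine K.isometry_adjoint rfl hAB hA hA' hs fun μ hμ hμs => ?_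
    obtain ⟨t, ht, htw⟩ := hfib μ hμ hμs
    exact ⟨t, ht, fun ν hν => ⟨⟨(μ, ν), (htw ν hν).1⟩, rfl, rfl, hkQ _ (htw ν hν).2⟩⟩
  have hTiso : Isometry (ContinuousLinearMap.adjoint A') := by
    refine K.isometry_adjoint rfl hAB' hA' hA hs' fun μ hμ hμs => ?_
    obtain ⟨t, ht, htz⟩ := hfib' μ hμ hμs
    exact ⟨t, ht, fun ν hν => ⟨⟨(ν, μ), (htz ν hν).1⟩, rfl, rfl, hkP _ (htz ν hν).2⟩⟩
  refine ⟨_, _, hS, hT, ⟨?_, ?_, ?_, ⟨p, hp.ne_zero, ?_⟩⟩, ?_, ?_⟩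
  · ext1 f
    refine RKHS.ext fun x => ?_
    rw [mul_apply_eq_comp, mul_apply_eq_comp, hS, hT, hT,
      hS, smul_comm]
  · exact RKHS.isPureIsometry_of_apply_eq_smul (a := fun x => x.1.1) (fun x => x.2.1)
      (fun f x => hS f x) hSiso
  · exact RKHS.isPureIsometry_of_apply_eq_smul (a := fun x => x.1.2) (fun x => x.2.2.1)
      (fun f x => hT f x) hTiso
  · ext1 f
    refine RKHS.ext fun x => ?_
    rw [polyOp_apply hS hT, x.2.2.2, zero_smul]
    simp
  · exact ⟨_, isNearlyCyclicFamily_columns hp hpt hAB (RKHS.adjoint_apply_eq_apply hB) hS hT hcQ⟩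
  · intro k hk f
    have hinf : (Metric.ball (0 : ℂ) 1 \ s).Infinite :=
      (infinite_of_mem_nhds (0 : ℂ) (Metric.ball_mem_nhds _ one_pos)).sdiff hs
    refine not_isNearlyCyclicFamily hA hS hT hinf (fun μ hμ => ?_) hk f
    obtain ⟨t, ht, htw⟩ := hfib μ (by simpa using hμ.1) hμ.2
    -- The fibre is nonempty because `p` has positive degree in `w`.
    obtain ⟨w, hw⟩ := Finset.card_pos.1 (ht ▸ Nat.pos_of_ne_zero (hpt.degreeOf_one_ne_zero xQ))
    exact ⟨⟨(μ, w), (htw w hw).1⟩, rfl, hkQ _ (htw w hw).2⟩
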